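/- A Gauss word is a finite word in which every letter that occurs in it occurs exactly twice; $\emptyset$ denotes the empty Gauss word. Two Gauss words are homotopic if one can be transformed into the other by a finite sequence of isomorphisms (bijective renamings of letters) and of the following moves and their inverses, where $A,B,C$ are letters, $x,y,z,t$ are arbitrary, possibly empty, sequences of letters, and both sides of a move are Gauss words: \[ \begin{array}{ll} \text{Shift:} & AxAy\to xAyA,\\ \text{H1:} & xAAy\to xy,\\ \text{H2:} & xAByBAz\to xyz,\\ \text{H3:} & xAByACzBCt\to xBAyCAzCBt. \end{array} \] They are open homotopic if this can be done without the shift move. A Gauss word is homotopically trivial if it is homotopic to $\emptyset$. A $2$-component Gauss phrase is a pair of words $w_1|w_2$ whose concatenation $w_1w_2$ is a Gauss word. Unordered homotopy of such phrases is the equivalence relation generated by isomorphisms (bijective renamings of letters applied to both components), the shift $Ax\to xA$ of a single component, the moves H1, H2, H3 (where $x,y,z,t$ may now contain the separator $|$, but the displayed pairs of adjacent letters may not be separated by it), and the exchange of the two components. Let $G$ be the free abelian group on the set of unordered homotopy classes of $2$-component Gauss phrases. For a Gauss word $w$ and a letter $A$ of $w$, write $w=xAyAz$ and let $u(w,A)$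 be the class of $y|xz$; let $t(w)$ be the class of $\emptyset|w$. Define $z(w)\in G/2G$ to be the image of $\sum_{A\in w}\bigl(u(w,A)-t(w)\bigr)\in G$. **Corollary 4.4.** There exist Gauss words that are not homotopically trivial. Consequently Turaev's conjecture, that every Gauss word is open homotopic to $\emptyset$, is false. Explicitly, for $w=ABACDCEBED$ (with $A,B,C,D,E$ distinct letters), $w$ is not homotopically trivial, $z(w)\neq 0$, and the $2$-component Gauss phrases $CEBE|ABAC$ and $\emptyset|w$ are not equivalent under unordered homotopy. -/

import Mathlib

namespace GaussHomotopy

/-! Letters are natural numbers: a countably infinite supply of letters, so that every finite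
alphabet is, up to renaming its letters, a finite set of letters in this sense. -/

/-- A word is a Gauss word (on the alphabet of the letters occurring in it) if each of its letters
occurs exactly twice. -/
def IsGauss (w : List ℕ) : Prop := ∀ a ∈ w, w.count a = 2

/-- The moves H1, H2 and H3, read from left to right, on sequences of symbols. The explicitly
displayed symbols are letters (embedded into the symbols by `ι`), whereas `x y z t` are arbitrary
sequences of symbols. For words, symbols are letters; for phrases, a symbol is a letter or
the component separator. -/
inductive HMove {σ : Type} (ι : ℕ → σ) : List σ → List σ → Prop
  | h1 (A : ℕ) (x y : List σ) :
      HMove ι (x ++ [ι A, ι A] ++ y) (x ++ y)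
  | h2 (A B : ℕ) (x y z : List σ) :
      HMove ι (x ++ [ι A, ι B] ++ y ++ [ι B, ι A] ++ z) (x ++ y ++ z)
  | h3 (A B C : ℕ) (x y z t : List σ) :
      HMove ι (x ++ [ι A, ι B] ++ y ++ [ι A, ι C] ++ z ++ [ι B, ι C] ++ t)
        (x ++ [ι B, ι A] ++ y ++ [ι C, ι A] ++ z ++ [ι C, ι B] ++ t)

/-- Gauss words. -/
@[ext]
structure GaussWord where
  /-- the underlying word -/
  word : List ℕ
  isGauss : IsGauss word

namespace GaussWord

/-- The trivial Gauss word `∅`. -/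
def empty : GaussWord := ⟨[], by simp [IsGauss]⟩

/-- The alphabet of a Gauss word: the set of its letters. -/
def alphabet (w : GaussWord) : Finset ℕ := w.word.toFinset

/-- Isomorphism of Gauss words: a bijection between the alphabets which, applied letterwise,
carries `u` to `v`. (Surjectivity onto the alphabet of `v` is automatic.) -/
def Iso (u v : GaussWord) : Prop :=
  ∃ f : ℕ → ℕ, Set.InjOn f {a | a ∈ u.word} ∧ u.word.map f = v.word

/-- The shift move `AxAy ⟶ xAyA`. -/
def Shift (u v : GaussWord) : Prop :=
  ∃ (A : ℕ) (x y : List ℕ), u.word = [A] ++ x ++ [A] ++ y ∧ v.word = x ++ [A] ++ y ++ [A]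

/-- An isomorphism or one of the moves H1, H2, H3 (in one direction). -/
def OpenStep (u v : GaussWord) : Prop := Iso u v ∨ HMove id u.word v.word

/-- An isomorphism or one of the moves shift, H1, H2, H3 (in one direction). -/
def Step (u v : GaussWord) : Prop := OpenStep u v ∨ Shift u v

/-- Open homotopy: a finite sequence of isomorphisms and moves H1, H2, H3, in either direction. -/
def OpenHomotopic : GaussWord → GaussWord → Prop := Relation.EqvGen OpenStep

/-- Homotopy: a finite sequence of isomorphisms and moves shift, H1, H2, H3, in either
direction. -/
def Homotopic : GaussWord → GaussWord → Prop := Relation.EqvGen Step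

/-- Homotopic to the trivial Gauss word. -/
def HomotopicallyTrivial (w : GaussWord) : Prop := Homotopic w empty

end GaussWord

/-- Gauss phrases with two components `fst|snd`. -/
@[ext]
structure GaussPhrase where
  /-- the first component -/
  fst : List ℕ
  /-- the second component -/
  snd : List ℕ
  isGauss : IsGauss (fst ++ snd)

namespace GaussPhrase

/-- The phrase `u|v` written as a sequence of symbols, with `none` as the separator `|`. -/
def symbols (p : GaussPhrase) : List (Option ℕ) :=
  p.fst.map some ++ [none] ++ p.snd.map some

/-- Isomorphism of two-component Gauss phrases. -/
def Iso (p q : GaussPhrase) : Prop :=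
  ∃ f : ℕ → ℕ, Set.InjOn f {a | a ∈ p.fst ++ p.snd} ∧
    p.fst.map f = q.fst ∧ p.snd.map f = q.snd

/-- The shift move `Ax ⟶ xA` applied to one of the two components. -/
def Shift (p q : GaussPhrase) : Prop :=
  (∃ (A : ℕ) (x : List ℕ), p.fst = [A] ++ x ∧ q.fst = x ++ [A] ∧ p.snd = q.snd) ∨
  (∃ (A : ℕ) (x : List ℕ), p.snd = [A] ++ x ∧ q.snd = x ++ [A] ∧ p.fst = q.fst)

/-- Permutation of the two components. -/
def Swap (p q : GaussPhrase) : Prop := p.fst = q.snd ∧ p.snd = q.fst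

/-- An elementary step of unordered homotopy (in one direction). -/
def Step (p q : GaussPhrase) : Prop :=
  Iso p q ∨ Shift p q ∨ HMove some p.symbols q.symbols ∨ Swap p q

/-- Unordered homotopy of two-component Gauss phrases. -/
def unorderedSetoid : Setoid GaussPhrase := Relation.EqvGen.setoid Step

/-- The set of unordered homotopy classes of two-component Gauss phrases. -/
abbrev Classes : Type := Quotient unorderedSetoid

/-- The unordered homotopy class of a two-component Gauss phrase. -/
def cls (p : GaussPhrase) : Classes := Quotient.mk unorderedSetoid p

end GaussPhrase

/-- For `w = xAyAz` with `A` not in `x`, `y`: the part `x`. -/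
def partX (w : List ℕ) (A : ℕ) : List ℕ := w.takeWhile (fun b => b ≠ A)

/-- The part of `w` after the first occurrence of `A`. -/
def afterFirst (w : List ℕ) (A : ℕ) : List ℕ := (w.dropWhile (fun b => b ≠ A)).tail

/-- For `w = xAyAz` with `A` not in `x`, `y`: the part `y`. -/
def partY (w : List ℕ) (A : ℕ) : List ℕ := partX (afterFirst w A) A

/-- For `w = xAyAz` with `A` not in `x`, `y`: the part `z`. -/
def partZ (w : List ℕ) (A : ℕ) : List ℕ := afterFirst (afterFirst w A) A

theorem eq_partX_append {w : List ℕ} {A : ℕ} (h : A ∈ w) :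
    w = partX w A ++ A :: afterFirst w A := by
  induction w with
  | nil => simp at h
  | cons b w ih =>
    by_cases hb : b = A
    · subst hb; simp [partX, afterFirst]
    · have h' : A ∈ w := by
        rcases List.mem_cons.1 h with h | h
        · exact absurd h.symm hb
        · exact h
      have := ih h'
      simpa [partX, afterFirst, hb] using this

theorem count_partX (w : List ℕ) (A : ℕ) : (partX w A).count A = 0 := by
  rw [List.count_eq_zero]
  intro h
  have := List.mem_takeWhile_imp h
  simp at this

/-- A Gauss word `w` containing `A` is `xAyAz` for the parts defined above. -/
theorem GaussWord.eq_parts (w : GaussWord) {A : ℕ} (h : A ∈ w.alphabet) :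
    w.word = partX w.word A ++ [A] ++ partY w.word A ++ [A] ++ partZ w.word A := by
  have hA : A ∈ w.word := by simpa [GaussWord.alphabet] using h
  have h1 := eq_partX_append hA
  have hc := w.isGauss A hA
  have h2 : A ∈ afterFirst w.word A := by
    rw [h1, List.count_append, count_partX, List.count_cons_self] at hc
    exact List.count_pos_iff.1 (by omega)
  have h3 := eq_partX_append h2
  rw [h3] at h1
  simpa [partY, partZ] using h1

theorem GaussWord.isGauss_smoothing (w : GaussWord) {A : ℕ} (h : A ∈ w.alphabet) :
    IsGauss (partY w.word A ++ (partX w.word A ++ partZ w.word A)) := by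
  have hA : A ∈ w.word := by simpa [GaussWord.alphabet] using h
  have hw := w.eq_parts h
  intro b hb
  have hbw : b ∈ w.word := by
    rw [hw]
    simp only [List.mem_append] at hb ⊢
    tauto
  have hcb := w.isGauss b hbw
  have hcA := w.isGauss A hA
  have hpos := List.count_pos_iff.2 hb
  rw [hw] at hcb hcA
  simp only [List.count_append, List.count_singleton_self] at hcb hcA hpos ⊢
  by_cases hbA : b = A
  · subst hbA; omega
  · have : List.count b [A] = 0 := by simp [Ne.symm hbA]
    omega

namespace GaussWord

/-- The Gauss phrase `p(w,A) = y|xz`, where `w = xAyAz`. -/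
def p (w : GaussWord) (A : ℕ) (hA : A ∈ w.alphabet) : GaussPhrase :=
  ⟨partY w.word A, partX w.word A ++ partZ w.word A, w.isGauss_smoothing hA⟩

/-- The Gauss phrase `∅|w`. -/
def emptyBar (w : GaussWord) : GaussPhrase := ⟨[], w.word, w.isGauss⟩

/-- `u(w,A)`: the unordered homotopy class of `p(w,A)`. -/
def u (w : GaussWord) (A : ℕ) (hA : A ∈ w.alphabet) : GaussPhrase.Classes := (w.p A hA).cls

/-- `t(w)`: the unordered homotopy class of `∅|w`. -/
def t (w : GaussWord) : GaussPhrase.Classes := w.emptyBar.cls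

end GaussWord

/-- The free abelian group `G` on the unordered homotopy classes of two-component Gauss
phrases. -/
abbrev G : Type := FreeAbelianGroup GaussPhrase.Classes

/-- The subgroup `2G` of `G`. -/
def twoG : AddSubgroup G := (zsmulAddGroupHom (2 : ℤ) : G →+ G).range

/-- The quotient `Z = G/2G`. -/
abbrev Z : Type := G ⧸ twoG

/-- The natural homomorphism from `G` to `Z`. -/
def theta : G →+ Z := QuotientAddGroup.mk' twoG

namespace GaussWord

/-- `g(w)`: the sum over the letters `A` of `w` of `u(w,A) - t(w)`. -/
noncomputable def g (w : GaussWord) : G :=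
  ∑ A : {A // A ∈ w.alphabet}, (FreeAbelianGroup.of (w.u A.1 A.2) - FreeAbelianGroup.of w.t)

/-- The invariant `z(w)`, the image of `g(w)` in `G/2G`. -/
noncomputable def z (w : GaussWord) : Z := theta w.g

/-- The Gauss word `ABACDCEBED`, with `A, B, C, D, E = 0, 1, 2, 3, 4`. -/
def witness : GaussWord := ⟨[0, 1, 0, 2, 3, 2, 4, 1, 4, 3], by unfold IsGauss; decide⟩

end GaussWord

/-- The Gauss phrase `CEBE|ABAC`, with `A, B, C, E = 0, 1, 2, 4`. -/
def GaussPhrase.witness : GaussPhrase :=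
  ⟨[2, 4, 1, 4], [0, 1, 0, 2], by unfold IsGauss; decide⟩

/-- Turaev's conjecture: every Gauss word is open homotopic to the empty Gauss word. -/
def TuraevConjecture : Prop := ∀ w : GaussWord, w.OpenHomotopic GaussWord.empty

end GaussHomotopy

/-!
The proof attaches to every two-component Gauss phrase `u|v` an element of `ZMod 2`. Call a letter
shared if it occurs in both components, and let `n(u)` be the number of pairs of positions `i < j`
of `u` such that position `i` carries a shared letter and position `j` an unshared one. With `m`
the number of shared letters, the invariant is `crossing u v = (1 + m) n(u) n(v)` modulo 2. (The
formal definition has a factor `1 + m` for each component, which is the same modulo 2.)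

* The invariant is unchanged under unordered homotopy. H1 and H2 delete pairs of adjacent positions
  that are both shared or both unshared (`cyclicInversions_remove_pair`). H3 makes three
  transpositions of adjacent positions, whose effects cancel whatever the distribution of the
  letters over the components (`splitCrossing_h3`). A shift of a shared letter changes `n(u)` by the
  number of unshared positions, which is even; a shift of an unshared letter changes it by `m`,
  which is harmless because of the factor `1 + m` (`cyclicInversions_shift`).
* The sum `totalCrossing w` of the invariants of `y|xz` over the letters `A` of a Gauss word
  `w = xAyAz` is a homotopy invariant of `w`. For a letter not displayed in a move, the phrases
  before and after it are related by the same kind of move. The letter displayed in H1 gives an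
  empty component and contributes zero; the two letters displayed in H2 make equal contributions,
  which cancel modulo 2; each letter displayed in H3 makes the same contribution before and after.
* For `w = ABACDCEBED` the only nonzero summand comes from the letter `D`, whose phrase is
  `CEBE|ABAC`. Hence `totalCrossing w = 1`, whereas the empty word has the value 0. Since `∅|w`
  has the invariant 0, the phrases `CEBE|ABAC` and `∅|w` are not equivalent, and the homomorphism
  from `G` to `ZMod 2` that extends the invariant sends `g(w)` to 1. It kills `2G`, so `z(w) ≠ 0`.

To treat words and phrases uniformly, `part D b w` splits a list at the occurrences of a symbol `D`,
which is either a letter of a Gauss word (occurring twice) or the separator of a phrase (occurring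
once).
-/

namespace GaussHomotopy

/-! ### A mod 2 invariant of pairs of lists -/

section ListInvariant

variable {σ τ : Type}

/-- The total weight, modulo 2, of a list whose letters are weighted by `s`. -/
def weight (s : σ → ZMod 2) (l : List σ) : ZMod 2 := (l.map s).sum

/-- The number, modulo 2, of letters of weight 0. -/
def coweight (s : σ → ZMod 2) (l : List σ) : ZMod 2 := (l.map fun E => 1 + s E).sum

/-- The number, modulo 2, of pairs of positions `i < j` where position `i` carries weight 1 and
position `j` carries weight 0. -/
def inversions (s : σ → ZMod 2) : List σ → ZMod 2
  | [] => 0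
  | E :: l => s E * coweight s l + inversions s l

/-- The inversion number, set to zero if the total weight is odd. The factor makes it invariant
under cyclic shifts. -/
def cyclicInversions (s : σ → ZMod 2) (l : List σ) : ZMod 2 := (1 + weight s l) * inversions s l

@[simp] theorem weight_nil (s : σ → ZMod 2) : weight s [] = 0 := rfl

@[simp] theorem weight_cons (s : σ → ZMod 2) (E : σ) (l : List σ) :
    weight s (E :: l) = s E + weight s l := by simp [weight]

@[simp] theorem weight_append (s : σ → ZMod 2) (l m : List σ) :
    weight s (l ++ m) = weight s l + weight s m := by simp [weight]

@[simp] theorem coweight_nil (s : σ → ZMod 2) : coweight s [] = 0 := rfl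

@[simp] theorem coweight_cons (s : σ → ZMod 2) (E : σ) (l : List σ) :
    coweight s (E :: l) = 1 + s E + coweight s l := by simp [coweight]

@[simp] theorem coweight_append (s : σ → ZMod 2) (l m : List σ) :
    coweight s (l ++ m) = coweight s l + coweight s m := by simp [coweight]

@[simp] theorem inversions_nil (s : σ → ZMod 2) : inversions s [] = 0 := rfl

@[simp] theorem inversions_cons (s : σ → ZMod 2) (E : σ) (l : List σ) :
    inversions s (E :: l) = s E * coweight s l + inversions s l := rfl

@[simp] theorem inversions_append (s : σ → ZMod 2) (l m : List σ) :
    inversions s (l ++ m) = inversions s l + inversions s m + weight s l * coweight s m := by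
  induction l with
  | nil => simp
  | cons E l ih => simp [ih]; ring

theorem two_eq_zero_mod : (2 : ZMod 2) = 0 := by decide

theorem sq_eq_self_mod (a : ZMod 2) : a * a = a := by revert a; decide

theorem cyclicInversions_congr {s t : σ → ZMod 2} {l : List σ} (h : ∀ E ∈ l, s E = t E) :
    cyclicInversions s l = cyclicInversions t l := by
  have hw : ∀ m : List σ, (∀ E ∈ m, s E = t E) →
      weight s m = weight t m ∧ coweight s m = coweight t m ∧ inversions s m = inversions t m := by
    intro m
    induction m with
    | nil => simp
    | cons E m ih =>
      intro hm
      obtain ⟨h1, h2, h3⟩ := ih fun F hF => hm F (List.mem_cons_of_mem _ hF)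
      simp [h1, h2, h3, hm E]
  obtain ⟨h1, -, h3⟩ := hw l h
  simp [cyclicInversions, h1, h3]

theorem cyclicInversions_map (g : σ → τ) (s : τ → ZMod 2) (l : List σ) :
    cyclicInversions s (l.map g) = cyclicInversions (fun E => s (g E)) l := by
  have hc : ∀ m : List σ, coweight s (m.map g) = coweight (fun E => s (g E)) m := by
    intro m; simp [coweight, Function.comp_def]
  have hi : inversions s (l.map g) = inversions (fun E => s (g E)) l := by
    induction l with
    | nil => rfl
    | cons E l ih => simp [ih, hc]
  simp [cyclicInversions, hi, weight, Function.comp_def]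

theorem cyclicInversions_remove_pair {s : σ → ZMod 2} {A B : σ} (h : s A = s B) (x y : List σ) :
    cyclicInversions s (x ++ [A, B] ++ y) = cyclicInversions s (x ++ y) := by
  have hw : weight s (x ++ [A, B] ++ y) = weight s (x ++ y) := by
    simp [h]; linear_combination s B * two_eq_zero_mod
  have hi : inversions s (x ++ [A, B] ++ y) = inversions s (x ++ y) := by
    simp [h]
    linear_combination sq_eq_self_mod (s B) +
      (s B + weight s x * (1 + s B) + s B * coweight s y) * two_eq_zero_mod
  rw [cyclicInversions, cyclicInversions, hw, hi]

/-- If the number of letters of weight 0 is even, the cyclic inversion number is invariant under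
cyclic shifts: moving a letter of weight 1 from the front to the end loses `coweight` inversions,
and moving a letter of weight 0 gains `weight` inversions. -/
theorem cyclicInversions_shift {s : σ → ZMod 2} {A : σ} {x : List σ}
    (h : coweight s (A :: x) = 0) :
    cyclicInversions s (x ++ [A]) = cyclicInversions s (A :: x) := by
  simp only [cyclicInversions, weight_append, weight_cons, weight_nil, inversions_append,
    inversions_cons, inversions_nil, coweight_cons, coweight_nil] at h ⊢
  generalize s A = a at *
  generalize weight s x = b at *
  generalize coweight s x = c at *
  generalize inversions s x = d at *
  revert a b c d; decide

/-- Replacing three blocks by blocks of the same weight and coweight changes the inversion number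
by the sum of the changes inside the blocks. -/
theorem inversions_replace (s : σ → ZMod 2) {P Q R P' Q' R' : List σ}
    (hP : weight s P' = weight s P) (hQ : weight s Q' = weight s Q) (hR : weight s R' = weight s R)
    (cP : coweight s P' = coweight s P) (cQ : coweight s Q' = coweight s Q)
    (cR : coweight s R' = coweight s R) (x y z t : List σ) :
    inversions s (x ++ P' ++ y ++ Q' ++ z ++ R' ++ t) =
      inversions s (x ++ P ++ y ++ Q ++ z ++ R ++ t) + (inversions s P' - inversions s P)
        + (inversions s Q' - inversions s Q) + (inversions s R' - inversions s R) := by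
  simp only [inversions_append, weight_append, hP, hQ, hR, cP, cQ, cR]
  ring

/-- The effect of H3 on a single component; `p`, `q`, `r` tell which of its three blocks lie in that
component. Transposing adjacent letters changes the inversion number by the sum of their weights. -/
theorem cyclicInversions_swaps (s : σ → ZMod 2) (A B C : σ) (x y z t : List σ) (p q r : Bool)
    (h : cond p (s A + s B) 0 + cond q (s A + s C) 0 + cond r (s B + s C) 0 = 0) :
    cyclicInversions s (x ++ cond p [B, A] [] ++ y ++ cond q [C, A] [] ++ z ++ cond r [C, B] [] ++ t)
      = cyclicInversions s
        (x ++ cond p [A, B] [] ++ y ++ cond q [A, C] [] ++ z ++ cond r [B, C] [] ++ t) := by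
  have hw : ∀ (b : Bool) (E F : σ), weight s (cond b [F, E] []) = weight s (cond b [E, F] []) := by
    intro b E F; cases b <;> simp [add_comm]
  have hc : ∀ (b : Bool) (E F : σ),
      coweight s (cond b [F, E] []) = coweight s (cond b [E, F] []) := by
    intro b E F; cases b <;> simp; ring
  have hi : ∀ (b : Bool) (E F : σ), inversions s (cond b [F, E] []) - inversions s (cond b [E, F] [])
      = cond b (s E + s F) 0 := by
    intro b E F
    cases b
    · simp
    · simp; linear_combination -(s E) * two_eq_zero_mod
  simp only [cyclicInversions, weight_append, hw]
  rw [inversions_replace s (hw p A B) (hw q A C) (hw r B C) (hc p A B) (hc q A C) (hc r B C)]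
  simp only [hi, add_assoc] at h ⊢
  rw [h, add_zero]

variable [DecidableEq σ] [DecidableEq τ]

/-- The weight of a letter is 1 if it occurs in both components of `u|v`. -/
def shared (u v : List σ) (E : σ) : ZMod 2 := if E ∈ u ∧ E ∈ v then 1 else 0

/-- The mod 2 invariant of the phrase `u|v`: the product of the cyclic inversion numbers of the
components, where letters are weighted by whether both components contain them. -/
def crossing (u v : List σ) : ZMod 2 :=
  cyclicInversions (shared u v) u * cyclicInversions (shared u v) v

theorem shared_comm (u v : List σ) : shared u v = shared v u := by
  funext E; simp [shared, and_comm]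

theorem crossing_comm (u v : List σ) : crossing u v = crossing v u := by
  rw [crossing, crossing, shared_comm, mul_comm]

@[simp] theorem crossing_nil_left (v : List σ) : crossing [] v = 0 := by
  simp [crossing, cyclicInversions]

@[simp] theorem crossing_nil_right (u : List σ) : crossing u [] = 0 := by
  simp [crossing, cyclicInversions]

theorem crossing_map {g : σ → τ} {u v : List σ} (hg : Set.InjOn g {a | a ∈ u ++ v}) :
    crossing (u.map g) (v.map g) = crossing u v := by
  have hs : ∀ E ∈ u ++ v, shared (u.map g) (v.map g) (g E) = shared u v E := by
    intro E hE
    have hm : ∀ l : List σ, (∀ F ∈ l, F ∈ u ++ v) → (g E ∈ l.map g ↔ E ∈ l) := by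
      intro l hl
      constructor
      · intro h
        obtain ⟨F, hF, hFE⟩ := List.mem_map.1 h
        rwa [← hg (hl F hF) hE hFE]
      · exact List.mem_map_of_mem
    simp only [shared, hm u fun F hF => List.mem_append_left _ hF,
      hm v fun F hF => List.mem_append_right _ hF]
  rw [crossing, crossing, cyclicInversions_map, cyclicInversions_map,
    cyclicInversions_congr fun E hE => hs E (List.mem_append_left _ hE),
    cyclicInversions_congr fun E hE => hs E (List.mem_append_right _ hE)]

/-- In a Gauss phrase every letter belonging to one component only occurs there twice, so the
number of such positions is even. -/
theorem coweight_shared_eq_zero {u v : List σ} (h : ∀ E ∈ u, (u ++ v).count E = 2) :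
    coweight (shared u v) u = 0 := by
  rw [coweight, Finset.sum_list_map_count]
  refine Finset.sum_eq_zero fun E hE => ?_
  have hE : E ∈ u := List.mem_toFinset.1 hE
  by_cases hv : E ∈ v
  · have : (1 : ZMod 2) + 1 = 0 := by decide
    simp [shared, hE, hv, this]
  · have h2 := h E hE
    rw [List.count_append, List.count_eq_zero_of_not_mem hv, add_zero] at h2
    rw [h2, nsmul_eq_mul, Nat.cast_ofNat, two_eq_zero_mod, zero_mul]

theorem crossing_shift_left {A : σ} {x v : List σ} (h : ∀ E ∈ A :: x, (A :: x ++ v).count E = 2) :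
    crossing (x ++ [A]) v = crossing (A :: x) v := by
  have hs : shared (x ++ [A]) v = shared (A :: x) v := by
    funext E; simp [shared, or_comm]
  rw [crossing, crossing, hs, cyclicInversions_shift (coweight_shared_eq_zero h)]

theorem crossing_shift_right {A : σ} {x u : List σ} (h : ∀ E ∈ A :: x, (u ++ A :: x).count E = 2) :
    crossing u (x ++ [A]) = crossing u (A :: x) := by
  rw [crossing_comm, crossing_shift_left, crossing_comm]
  intro E hE
  rw [← h E hE, List.count_append, List.count_append, add_comm]

/-- The weights may be computed before the components are reduced from `u|v` to `u'|v'`, as long as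
the surviving letters have the weights they have in `u'|v'`. -/
theorem crossing_eq_of_shared {u v u' v' : List σ} {s : σ → ZMod 2}
    (hu : cyclicInversions (shared u v) u = cyclicInversions s u')
    (hv : cyclicInversions (shared u v) v = cyclicInversions s v')
    (h : ∀ E ∈ u' ++ v', s E = shared u' v' E) : crossing u v = crossing u' v' := by
  rw [crossing, crossing, hu, hv, cyclicInversions_congr fun E hE => h E (List.mem_append_left _ hE),
    cyclicInversions_congr fun E hE => h E (List.mem_append_right _ hE)]

theorem crossing_remove_pair {A B : σ} {x y v : List σ} (hA : A ∉ x ++ y) (hB : B ∉ x ++ y)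
    (hAv : A ∉ v) (hBv : B ∉ v) : crossing (x ++ [A, B] ++ y) v = crossing (x ++ y) v := by
  refine crossing_eq_of_shared (cyclicInversions_remove_pair ?_ x y) rfl fun E hE => ?_
  · simp [shared, hAv, hBv]
  · have h1 : E ≠ A := by rintro rfl; simp_all
    have h2 : E ≠ B := by rintro rfl; simp_all
    simp [shared, h1, h2]

/-- A pair of letters adjacent in both components, in either order, can be dropped. Unlike in H2, the
order may be the same in both components. -/
theorem crossing_remove_pairs {A B : σ} {x y z t : List σ} (hA : A ∉ x ++ y ++ z ++ t)
    (hB : B ∉ x ++ y ++ z ++ t) (u v : List σ) (hu : u = [A, B] ∨ u = [B, A])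
    (hv : v = [A, B] ∨ v = [B, A]) :
    crossing (x ++ u ++ y) (z ++ v ++ t) = crossing (x ++ y) (z ++ t) := by
  have hs : shared (x ++ u ++ y) (z ++ v ++ t) A = shared (x ++ u ++ y) (z ++ v ++ t) B := by
    rcases hu with rfl | rfl <;> rcases hv with rfl | rfl <;> simp [shared]
  refine crossing_eq_of_shared (s := shared (x ++ u ++ y) (z ++ v ++ t)) ?_ ?_ fun E hE => ?_
  · rcases hu with rfl | rfl
    · exact cyclicInversions_remove_pair hs x y
    · exact cyclicInversions_remove_pair hs.symm x y
  · rcases hv with rfl | rfl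
    · exact cyclicInversions_remove_pair hs z t
    · exact cyclicInversions_remove_pair hs.symm z t
  · have h1 : E ≠ A := by rintro rfl; simp_all
    have h2 : E ≠ B := by rintro rfl; simp_all
    rcases hu with rfl | rfl <;> rcases hv with rfl | rfl <;> simp [shared, h1, h2]

end ListInvariant

/-! ### Splitting a word at the occurrences of a letter -/

section Splitting

variable {σ : Type} [DecidableEq σ]

/-- The subsequence of `w` read while a switch is on: the switch starts in position `b`, and
each occurrence of `D` toggles it. If `w = xDyDz`, then `part D true w = xz` and
`part D false w = y`; if `w = xDy`, then `part D true w = x` and `part D false w = y`. -/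
def part (D : σ) : Bool → List σ → List σ
  | _, [] => []
  | b, E :: w => if E = D then part D (!b) w else cond b [E] [] ++ part D b w

@[simp] theorem part_nil (D : σ) (b : Bool) : part D b [] = [] := rfl

/-- The position after reading `w` of the switch that starts in position `b`. -/
def switch (D : σ) (b : Bool) (w : List σ) : Bool := b ^^ (w.count D).bodd

theorem switch_not (D : σ) (b : Bool) (w : List σ) : switch D (!b) w = !switch D b w := by
  simp [switch]

@[simp] theorem switch_append (D : σ) (b : Bool) (w w' : List σ) :
    switch D b (w ++ w') = switch D (switch D b w) w' := by
  simp [switch, List.count_append]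

theorem switch_of_notMem {D : σ} {w : List σ} (h : D ∉ w) (b : Bool) : switch D b w = b := by
  simp [switch, List.count_eq_zero_of_not_mem h]

@[simp] theorem part_append (D : σ) (b : Bool) (w w' : List σ) :
    part D b (w ++ w') = part D b w ++ part D (switch D b w) w' := by
  induction w generalizing b with
  | nil => simp [part, switch]
  | cons E w ih =>
    by_cases h : E = D
    · subst h; simp [part, ih, switch]
    · simp [part, ih, switch, h]

theorem part_of_notMem {D : σ} {w : List σ} (h : D ∉ w) (b : Bool) :
    part D b w = cond b w [] := by
  induction w with
  | nil => cases b <;> rfl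
  | cons E w ih =>
    have h1 : E ≠ D := by rintro rfl; simp at h
    rw [part, if_neg h1, ih fun hw => h (List.mem_cons_of_mem _ hw)]
    cases b <;> simp

@[simp] theorem part_cons_self (D : σ) (b : Bool) (w : List σ) :
    part D b (D :: w) = part D (!b) w := by simp [part]

theorem part_cons_of_ne {D E : σ} (h : E ≠ D) (b : Bool) (w : List σ) :
    part D b (E :: w) = cond b [E] [] ++ part D b w := by simp [part, h]

theorem notMem_part {D E : σ} {w : List σ} (h : E ∉ w) (b : Bool) : E ∉ part D b w := by
  induction w generalizing b with
  | nil => simp [part]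
  | cons F w ih =>
    have h1 := List.not_mem_of_not_mem_cons h
    rw [part]
    split_ifs
    · exact ih h1 _
    · cases b
      · simpa using ih h1 _
      · simpa using ⟨List.ne_of_not_mem_cons h, ih h1 _⟩

theorem notMem_part_self (D : σ) (w : List σ) (b : Bool) : D ∉ part D b w := by
  induction w generalizing b with
  | nil => simp
  | cons F w ih =>
    by_cases h : F = D
    · subst h
      rw [part_cons_self]
      exact ih _
    · rw [part_cons_of_ne h]
      cases b
      · simpa using ih _
      · simpa using ⟨Ne.symm h, ih _⟩

theorem part_map {τ : Type} [DecidableEq τ] {g : σ → τ} {D : σ} {w : List σ}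
    (hg : ∀ E ∈ w, g E = g D → E = D) (b : Bool) : part (g D) b (w.map g) = (part D b w).map g := by
  induction w generalizing b with
  | nil => rfl
  | cons E w ih =>
    have ih := ih fun F hF => hg F (List.mem_cons_of_mem _ hF)
    by_cases h : E = D
    · subst h; simp [ih]
    · have h' : g E ≠ g D := fun he => h (hg E List.mem_cons_self he)
      rw [List.map_cons, part_cons_of_ne h', part_cons_of_ne h, ih]
      cases b <;> simp

theorem count_part_add_count_part {D E : σ} (h : E ≠ D) (w : List σ) (b : Bool) :
    (part D b w).count E + (part D (!b) w).count E = w.count E := by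
  induction w generalizing b with
  | nil => rfl
  | cons F w ih =>
    by_cases hF : F = D
    · subst hF
      simpa [List.count_cons_of_ne h.symm] using ih (!b)
    · rw [part_cons_of_ne hF, part_cons_of_ne hF]
      have := ih b
      cases b <;> simp [List.count_cons] at this ⊢ <;> omega

/-- The invariant `crossing` of the phrase obtained by splitting `w` at the occurrences of `D`. -/
def splitCrossing (D : σ) (w : List σ) : ZMod 2 := crossing (part D true w) (part D false w)

end Splitting

/-! ### Effect of the moves on the letters that are not displayed -/

section Moves

variable {σ : Type} [DecidableEq σ]

theorem splitCrossing_h1 {D A : σ} {x y : List σ} (hD : A ≠ D) (hA : A ∉ x ++ y) :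
    splitCrossing D (x ++ [A, A] ++ y) = splitCrossing D (x ++ y) := by
  have hm : D ∉ [A, A] := by simp [hD.symm]
  simp only [List.mem_append, not_or] at hA
  obtain ⟨hx, hy⟩ := hA
  simp only [splitCrossing, part_append, switch_append, part_of_notMem hm, switch_of_notMem hm]
  rw [← Bool.not_true, switch_not]
  cases switch D true x
  · simp only [cond, Bool.not_false, List.append_nil]
    rw [crossing_comm, crossing_remove_pair, crossing_comm] <;> simp [notMem_part, *]
  · simp only [cond, Bool.not_true, List.append_nil]
    rw [crossing_remove_pair] <;> simp [notMem_part, *]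

theorem splitCrossing_h2 {D A B : σ} {x y z : List σ} (hAD : A ≠ D) (hBD : B ≠ D)
    (hA : A ∉ x ++ y ++ z) (hB : B ∉ x ++ y ++ z) :
    splitCrossing D (x ++ [A, B] ++ y ++ [B, A] ++ z) = splitCrossing D (x ++ y ++ z) := by
  have hm : D ∉ [A, B] := by simp [hAD.symm, hBD.symm]
  have hm' : D ∉ [B, A] := by simp [hAD.symm, hBD.symm]
  simp only [List.mem_append, not_or] at hA hB
  obtain ⟨⟨hAx, hAy⟩, hAz⟩ := hA
  obtain ⟨⟨hBx, hBy⟩, hBz⟩ := hB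
  simp only [splitCrossing, part_append, switch_append, part_of_notMem hm, switch_of_notMem hm,
    part_of_notMem hm', switch_of_notMem hm']
  rw [← Bool.not_true]
  simp only [switch_not]
  generalize switch D true x = p
  generalize switch D p y = q
  have key : ∀ X Y Z T : List σ, A ∉ X ++ Y ++ Z ++ T → B ∉ X ++ Y ++ Z ++ T →
      crossing (X ++ [A, B] ++ Y ++ [B, A] ++ Z) T = crossing (X ++ Y ++ Z) T := by
    intro X Y Z T h1 h2
    -- Both pairs lie in the same component, so neither letter is shared.
    refine crossing_eq_of_shared (s := shared (X ++ [A, B] ++ Y ++ [B, A] ++ Z) T) ?_ rfl ?_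
    · have hs : shared (X ++ [A, B] ++ Y ++ [B, A] ++ Z) T A
          = shared (X ++ [A, B] ++ Y ++ [B, A] ++ Z) T B := by
        simp_all [shared]
      rw [cyclicInversions_remove_pair hs.symm]
      simpa only [List.append_assoc] using cyclicInversions_remove_pair hs X (Y ++ Z)
    · intro E hE
      have h3 : E ≠ A := by rintro rfl; simp_all
      have h4 : E ≠ B := by rintro rfl; simp_all
      simp [shared, h3, h4]
  cases p <;> cases q <;> simp only [cond, Bool.not_false, Bool.not_true, List.append_nil]
  · rw [crossing_comm, key, crossing_comm] <;> simp [notMem_part, *]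
  · have := crossing_remove_pairs (A := A) (B := B) (x := part D true x ++ part D false y)
      (y := part D true z) (z := part D false x) (t := part D true y ++ part D false z)
      (by simp [notMem_part, *]) (by simp [notMem_part, *]) _ _ (.inr rfl) (.inl rfl)
    simpa only [List.append_assoc] using this
  · have := crossing_remove_pairs (A := A) (B := B) (x := part D true x)
      (y := part D true y ++ part D false z) (z := part D false x ++ part D false y)
      (t := part D true z)
      (by simp [notMem_part, *]) (by simp [notMem_part, *]) _ _ (.inl rfl) (.inr rfl)
    simpa only [List.append_assoc] using this
  · rw [key] <;> simp [notMem_part, *]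

theorem splitCrossing_h3 {D A B C : σ} {x y z t : List σ} (hAD : A ≠ D) (hBD : B ≠ D)
    (hCD : C ≠ D) (hAB : A ≠ B) (hAC : A ≠ C) (hBC : B ≠ C)
    (hA : A ∉ x ++ y ++ z ++ t) (hB : B ∉ x ++ y ++ z ++ t) (hC : C ∉ x ++ y ++ z ++ t) :
    splitCrossing D (x ++ [B, A] ++ y ++ [C, A] ++ z ++ [C, B] ++ t) =
      splitCrossing D (x ++ [A, B] ++ y ++ [A, C] ++ z ++ [B, C] ++ t) := by
  have hm : ∀ E F : σ, E ≠ D → F ≠ D → D ∉ [E, F] := fun E F hE hF => by simp [hE.symm, hF.symm]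
  simp only [List.mem_append, not_or] at hA hB hC
  obtain ⟨⟨⟨hAx, hAy⟩, hAz⟩, hAt⟩ := hA
  obtain ⟨⟨⟨hBx, hBy⟩, hBz⟩, hBt⟩ := hB
  obtain ⟨⟨⟨hCx, hCy⟩, hCz⟩, hCt⟩ := hC
  simp only [splitCrossing, part_append, switch_append, part_of_notMem (hm _ _ hAD hBD),
    switch_of_notMem (hm _ _ hAD hBD), part_of_notMem (hm _ _ hBD hAD),
    switch_of_notMem (hm _ _ hBD hAD), part_of_notMem (hm _ _ hAD hCD),
    switch_of_notMem (hm _ _ hAD hCD), part_of_notMem (hm _ _ hCD hAD),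
    switch_of_notMem (hm _ _ hCD hAD), part_of_notMem (hm _ _ hBD hCD),
    switch_of_notMem (hm _ _ hBD hCD), part_of_notMem (hm _ _ hCD hBD),
    switch_of_notMem (hm _ _ hCD hBD)]
  rw [← Bool.not_true]
  simp only [switch_not]
  generalize switch D true x = p
  generalize switch D p y = q
  generalize switch D q z = r
  have hs : ∀ X Y Z T X' Y' Z' T' : List σ,
      A ∉ X ++ Y ++ Z ++ T ++ X' ++ Y' ++ Z' ++ T' → B ∉ X ++ Y ++ Z ++ T ++ X' ++ Y' ++ Z' ++ T' →
      C ∉ X ++ Y ++ Z ++ T ++ X' ++ Y' ++ Z' ++ T' →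
      crossing
        (X ++ cond p [B, A] [] ++ Y ++ cond q [C, A] [] ++ Z ++ cond r [C, B] [] ++ T)
        (X' ++ cond (!p) [B, A] [] ++ Y' ++ cond (!q) [C, A] [] ++ Z' ++ cond (!r) [C, B] [] ++ T')
      = crossing
        (X ++ cond p [A, B] [] ++ Y ++ cond q [A, C] [] ++ Z ++ cond r [B, C] [] ++ T)
        (X' ++ cond (!p) [A, B] [] ++ Y' ++ cond (!q) [A, C] [] ++ Z' ++ cond (!r) [B, C] [] ++ T')
      := by
    intro X Y Z T X' Y' Z' T' h1 h2 h3
    have hmem : ∀ (b : Bool) (E F G : σ), G ∈ cond b [F, E] [] ↔ G ∈ cond b [E, F] [] := by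
      intro b E F G; cases b <;> simp [or_comm]
    have hsh : shared
        (X ++ cond p [B, A] [] ++ Y ++ cond q [C, A] [] ++ Z ++ cond r [C, B] [] ++ T)
        (X' ++ cond (!p) [B, A] [] ++ Y' ++ cond (!q) [C, A] [] ++ Z' ++ cond (!r) [C, B] [] ++ T')
      = shared
        (X ++ cond p [A, B] [] ++ Y ++ cond q [A, C] [] ++ Z ++ cond r [B, C] [] ++ T)
        (X' ++ cond (!p) [A, B] [] ++ Y' ++ cond (!q) [A, C] [] ++ Z' ++ cond (!r) [B, C] [] ++ T')
      := by
      funext G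
      simp only [shared, List.mem_append, hmem _ A B, hmem _ A C, hmem _ B C]
    -- A displayed letter is shared exactly if its two blocks lie in different components.
    have hsw : ∀ s : σ → ZMod 2, s = shared
        (X ++ cond p [A, B] [] ++ Y ++ cond q [A, C] [] ++ Z ++ cond r [B, C] [] ++ T)
        (X' ++ cond (!p) [A, B] [] ++ Y' ++ cond (!q) [A, C] [] ++ Z' ++ cond (!r) [B, C] [] ++ T') →
        s A = cond (p ^^ q) 1 0 ∧ s B = cond (p ^^ r) 1 0 ∧ s C = cond (q ^^ r) 1 0 := by
      rintro s rfl
      simp only [List.mem_append, not_or] at h1 h2 h3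
      cases p <;> cases q <;> cases r <;>
        simp [shared, h1, h2, h3, hAB, hAC, hBC, hAB.symm, hAC.symm, hBC.symm]
    obtain ⟨sA, sB, sC⟩ := hsw _ rfl
    -- With these weights the changes caused by the three transpositions sum to zero.
    rw [crossing, crossing, hsh, cyclicInversions_swaps, cyclicInversions_swaps] <;>
    · rw [sA, sB, sC]
      cases p <;> cases q <;> cases r <;> decide
  apply hs <;> simp [notMem_part, *]

end Moves

/-! ### Displayed letters of a move do not occur elsewhere -/

section Counting

variable {σ : Type} [BEq σ] [LawfulBEq σ]

theorem notMem_of_count_h1 {A : σ} {x y : List σ} (h : (x ++ [A, A] ++ y).count A = 2) :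
    A ∉ x ++ y := by
  rw [← List.count_eq_zero]
  simp [List.count_append] at h ⊢
  omega

theorem notMem_of_count_h2 {A B : σ} {x y z : List σ}
    (hA : (x ++ [A, B] ++ y ++ [B, A] ++ z).count A = 2)
    (hB : (x ++ [A, B] ++ y ++ [B, A] ++ z).count B = 2) :
    A ≠ B ∧ A ∉ x ++ y ++ z ∧ B ∉ x ++ y ++ z := by
  have hAB : A ≠ B := by
    rintro rfl
    simp [List.count_append] at hA
    omega
  have hBA := hAB.symm
  refine ⟨hAB, ?_, ?_⟩ <;> rw [← List.count_eq_zero] <;>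
    simp [List.count_append, hAB, hBA] at hA hB ⊢ <;> omega

theorem notMem_of_count_h3 {A B C : σ} {x y z t : List σ}
    (hA : (x ++ [A, B] ++ y ++ [A, C] ++ z ++ [B, C] ++ t).count A = 2)
    (hB : (x ++ [A, B] ++ y ++ [A, C] ++ z ++ [B, C] ++ t).count B = 2)
    (hC : (x ++ [A, B] ++ y ++ [A, C] ++ z ++ [B, C] ++ t).count C = 2) :
    (A ≠ B ∧ A ≠ C ∧ B ≠ C) ∧
      A ∉ x ++ y ++ z ++ t ∧ B ∉ x ++ y ++ z ++ t ∧ C ∉ x ++ y ++ z ++ t := by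
  have hAB : A ≠ B := by
    rintro rfl
    simp [List.count_append, List.count_cons] at hA
    omega
  have hAC : A ≠ C := by
    rintro rfl
    simp [List.count_append, List.count_cons] at hA
    omega
  have hBC : B ≠ C := by
    rintro rfl
    simp [List.count_append, List.count_cons] at hB
    omega
  have hBA := hAB.symm
  have hCA := hAC.symm
  have hCB := hBC.symm
  refine ⟨⟨hAB, hAC, hBC⟩, ?_, ?_, ?_⟩ <;> rw [← List.count_eq_zero] <;>
    simp [List.count_append, hAB, hBA, hAC, hCA, hBC, hCB] at hA hB hC ⊢ <;> omega

end Counting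

/-! ### Unordered homotopy of phrases -/

namespace GaussPhrase

/-- The mod 2 invariant of a two-component Gauss phrase. -/
def crossing (p : GaussPhrase) : ZMod 2 := GaussHomotopy.crossing p.fst p.snd

theorem splitCrossing_symbols (p : GaussPhrase) : splitCrossing none p.symbols = p.crossing := by
  have h : ∀ l : List ℕ, none ∉ l.map some := by simp
  have h1 : switch none true [(none : Option ℕ)] = false := by decide
  have h2 : switch none false [(none : Option ℕ)] = true := by decide
  have h3 : ∀ b, part none b [(none : Option ℕ)] = [] := by decide
  rw [splitCrossing, symbols]
  simp only [part_append, switch_append, part_of_notMem (h _), switch_of_notMem (h _), h1, h2, h3,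
    cond, List.append_nil, List.nil_append]
  exact crossing_map (Option.some_injective ℕ).injOn

theorem count_symbols (p : GaussPhrase) (a : ℕ) :
    p.symbols.count (some a) = (p.fst ++ p.snd).count a := by
  rw [symbols, List.count_append, List.count_append,
    List.count_map_of_injective _ _ (Option.some_injective ℕ),
    List.count_map_of_injective _ _ (Option.some_injective ℕ), List.count_append]
  simp

theorem splitCrossing_none_of_hMove {l l' : List (Option ℕ)} (h : HMove some l l')
    (hl : ∀ a, some a ∈ l → l.count (some a) = 2) :
    splitCrossing none l = splitCrossing none l' := by
  cases h with
  | h1 A x y =>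
    exact splitCrossing_h1 (by simp) (notMem_of_count_h1 (hl A (by simp)))
  | h2 A B x y z =>
    obtain ⟨-, hA, hB⟩ := notMem_of_count_h2 (hl A (by simp)) (hl B (by simp))
    exact splitCrossing_h2 (by simp) (by simp) hA hB
  | h3 A B C x y z t =>
    obtain ⟨⟨hAB, hAC, hBC⟩, hA, hB, hC⟩ :=
      notMem_of_count_h3 (hl A (by simp)) (hl B (by simp)) (hl C (by simp))
    exact (splitCrossing_h3 (by simp) (by simp) (by simp) hAB hAC hBC hA hB hC).symm

theorem crossing_eq_of_step {p q : GaussPhrase} (h : Step p q) : p.crossing = q.crossing := by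
  rcases h with ⟨f, hf, h1, h2⟩ | h | h | ⟨h1, h2⟩
  · rw [crossing, crossing, ← h1, ← h2, crossing_map hf]
  · rcases h with ⟨A, x, h1, h2, h3⟩ | ⟨A, x, h1, h2, h3⟩
    · rw [crossing, crossing, h1, h2, ← h3]
      refine (crossing_shift_left fun E hE => ?_).symm
      have := p.isGauss E (by rw [h1]; exact List.mem_append_left _ hE)
      rwa [h1] at this
    · rw [crossing, crossing, h1, h2, ← h3]
      refine (crossing_shift_right fun E hE => ?_).symm
      have := p.isGauss E (by rw [h1]; exact List.mem_append_right _ hE)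
      rwa [h1] at this
  · rw [← splitCrossing_symbols, ← splitCrossing_symbols]
    refine splitCrossing_none_of_hMove h fun a ha => ?_
    rw [← List.count_pos_iff, count_symbols, List.count_pos_iff] at ha
    rw [count_symbols, p.isGauss a ha]
  · rw [crossing, crossing, h1, h2, crossing_comm]

theorem crossing_eq_of_rel {p q : GaussPhrase} (h : unorderedSetoid p q) :
    p.crossing = q.crossing := by
  induction h with
  | rel _ _ h => exact crossing_eq_of_step h
  | refl => rfl
  | symm _ _ _ ih => exact ih.symm
  | trans _ _ _ _ _ ih1 ih2 => exact ih1.trans ih2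

/-- The invariant `crossing` on unordered homotopy classes. -/
def Classes.crossing : Classes → ZMod 2 :=
  Quotient.lift GaussPhrase.crossing fun _ _ h => crossing_eq_of_rel h

end GaussPhrase

/-! ### Homotopy of Gauss words -/

/-- The mod 2 invariant of a Gauss word: the sum of the invariants of the phrases obtained by
splitting the word at each of its letters. -/
def totalCrossing (w : List ℕ) : ZMod 2 := ∑ D ∈ w.toFinset, splitCrossing D w

theorem totalCrossing_map {f : ℕ → ℕ} {w : List ℕ} (hf : Set.InjOn f {a | a ∈ w}) :
    totalCrossing (w.map f) = totalCrossing w := by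
  have himg : (w.map f).toFinset = w.toFinset.image f := by ext; simp
  have hmem : ∀ (D : ℕ) (b : Bool), ∀ E ∈ part D b w, E ∈ w := fun D b E hE => by
    by_contra hEw
    exact notMem_part hEw b hE
  rw [totalCrossing, himg, Finset.sum_image (by simpa using hf), totalCrossing]
  refine Finset.sum_congr rfl fun D hD => ?_
  have hD : D ∈ w := List.mem_toFinset.1 hD
  have hp := part_map (g := f) (D := D) (w := w) fun E hE h => hf hE hD h
  rw [splitCrossing, hp, hp, crossing_map, splitCrossing]
  refine hf.mono fun E hE => ?_
  rcases List.mem_append.1 hE with h | h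
  · exact hmem D _ E h
  · exact hmem D _ E h

theorem totalCrossing_shift {A : ℕ} {w : List ℕ} (h : IsGauss (A :: w)) :
    totalCrossing (w ++ [A]) = totalCrossing (A :: w) := by
  have hset : (w ++ [A]).toFinset = (A :: w).toFinset := by ext; simp
  rw [totalCrossing, totalCrossing, hset]
  refine Finset.sum_congr rfl fun D hD => ?_
  rw [List.mem_toFinset] at hD
  by_cases hDA : A = D
  · -- The two components are exchanged.
    subst hDA
    simp only [splitCrossing, part_append, part_cons_self, part_nil, List.append_nil]
    exact crossing_comm (part A true w) (part A false w)
  · -- One of the components undergoes a shift.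
    have heven : (w.count D).bodd = false := by
      have := h D hD
      rw [List.count_cons_of_ne hDA] at this
      rw [this]; rfl
    have hsw : ∀ b, switch D b w = b := fun b => by simp [switch, heven]
    simp only [splitCrossing, part_append, part_cons_of_ne hDA, hsw, cond, part_nil, List.append_nil,
      List.nil_append, List.singleton_append]
    refine crossing_shift_left fun E hE => ?_
    have hED : E ≠ D := by
      rintro rfl
      rcases List.mem_cons.1 hE with h1 | h1
      · exact hDA h1.symm
      · exact notMem_part_self E w true h1
    have h1 := count_part_add_count_part hED (A :: w) true
    rw [part_cons_of_ne hDA, part_cons_of_ne hDA] at h1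
    simp only [cond, Bool.not_true, List.nil_append, List.singleton_append] at h1
    rw [List.count_append, h1]
    refine h E ?_
    rcases List.mem_cons.1 hE with h1 | h1
    · exact h1 ▸ List.mem_cons_self
    · by_contra h2
      exact notMem_part (fun h3 => h2 (List.mem_cons_of_mem _ h3)) _ h1

theorem totalCrossing_h1 {A : ℕ} {x y : List ℕ} (h : IsGauss (x ++ [A, A] ++ y)) :
    totalCrossing (x ++ [A, A] ++ y) = totalCrossing (x ++ y) := by
  have hA := notMem_of_count_h1 (h A (by simp))
  have hset : (x ++ [A, A] ++ y).toFinset = insert A (x ++ y).toFinset := by ext; simp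
  rw [totalCrossing, hset, Finset.sum_insert (by simpa using hA), totalCrossing]
  have h0 : splitCrossing A (x ++ [A, A] ++ y) = 0 := by
    simp only [List.mem_append, not_or] at hA
    simp [splitCrossing, part_of_notMem hA.1, part_of_notMem hA.2, part, switch,
      List.count_eq_zero_of_not_mem hA.1]
  rw [h0, zero_add]
  refine Finset.sum_congr rfl fun D hD => splitCrossing_h1 ?_ hA
  rintro rfl
  exact hA (List.mem_toFinset.1 hD)

theorem totalCrossing_h2 {A B : ℕ} {x y z : List ℕ}
    (h : IsGauss (x ++ [A, B] ++ y ++ [B, A] ++ z)) (h' : IsGauss (x ++ y ++ z)) :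
    totalCrossing (x ++ [A, B] ++ y ++ [B, A] ++ z) = totalCrossing (x ++ y ++ z) := by
  obtain ⟨hAB, hA, hB⟩ := notMem_of_count_h2 (h A (by simp)) (h B (by simp))
  have hset : (x ++ [A, B] ++ y ++ [B, A] ++ z).toFinset
      = insert A (insert B (x ++ y ++ z).toFinset) := by ext; simp; tauto
  rw [totalCrossing, hset, Finset.sum_insert (by simpa [hAB] using hA),
    Finset.sum_insert (by simpa using hB), totalCrossing]
  have hD : ∀ D ∈ (x ++ y ++ z).toFinset, splitCrossing D (x ++ [A, B] ++ y ++ [B, A] ++ z)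
      = splitCrossing D (x ++ y ++ z) := by
    intro D hD
    rw [List.mem_toFinset] at hD
    refine splitCrossing_h2 ?_ ?_ hA hB
    · rintro rfl; exact hA hD
    · rintro rfl; exact hB hD
  rw [Finset.sum_congr rfl hD]
  simp only [List.mem_append, not_or] at hA hB
  obtain ⟨⟨hAx, hAy⟩, hAz⟩ := hA
  obtain ⟨⟨hBx, hBy⟩, hBz⟩ := hB
  -- Splitting at `A` yields `xz|ByB`, splitting at `B` yields `xAAz|y`.
  have e1 : splitCrossing A (x ++ [A, B] ++ y ++ [B, A] ++ z) = crossing (x ++ z) (B :: y ++ [B]) := by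
    simp [splitCrossing, part, switch, part_of_notMem, List.count_eq_zero_of_not_mem, hAx, hAy,
      hAz, hAB.symm]
  have e2 : splitCrossing B (x ++ [A, B] ++ y ++ [B, A] ++ z) = crossing (x ++ [A, A] ++ z) y := by
    simp [splitCrossing, part, switch, part_of_notMem, List.count_eq_zero_of_not_mem, hBx, hBy,
      hBz, hAB]
  have e3 : crossing (x ++ [A, A] ++ z) y = crossing (x ++ z) y := by
    apply crossing_remove_pair <;> simp [*]
  have e4 : crossing (x ++ z) (B :: y ++ [B]) = crossing (x ++ z) y := by
    rw [List.cons_append, ← crossing_shift_right (A := B) (x := y ++ [B])]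
    · rw [crossing_comm, List.append_assoc]
      have := crossing_remove_pair (A := B) (B := B) (x := y) (y := []) (v := x ++ z)
      simp only [List.append_nil] at this
      rw [crossing_comm _ y]
      apply this <;> simp [*]
    · intro E hE
      by_cases hEB : E = B
      · subst hEB
        simp [List.count_append, List.count_eq_zero_of_not_mem, *]
      · have hEy : E ∈ y := by simpa [hEB] using hE
        rw [← h' E (by simp [hEy])]
        simp [List.count_append, Ne.symm hEB]
        omega
  rw [e1, e2, e3, e4, ← add_assoc, ← two_mul, two_eq_zero_mod, zero_mul, zero_add]

theorem map_swap_of_notMem {B C : ℕ} {x : List ℕ} (hB : B ∉ x) (hC : C ∉ x) :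
    x.map (Equiv.swap B C) = x := by
  conv_rhs => rw [← List.map_id x]
  refine List.map_congr_left fun E hE => Equiv.swap_apply_of_ne_of_ne ?_ ?_
  · rintro rfl; exact hB hE
  · rintro rfl; exact hC hE

/-- Splitting both sides of H3 at the displayed letter `A` yields `xCzBCt|By` and `xBzCBt|yC`,
which differ by a shift and by exchanging the names of `B` and `C`. -/
theorem splitCrossing_h3_fst {A B C : ℕ} {x y z t : List ℕ} (hAB : A ≠ B) (hAC : A ≠ C)
    (hA : A ∉ x ++ y ++ z ++ t) (hB : B ∉ x ++ y ++ z ++ t)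
    (hC : C ∉ x ++ y ++ z ++ t)
    (h : IsGauss (x ++ [A, B] ++ y ++ [A, C] ++ z ++ [B, C] ++ t)) :
    splitCrossing A (x ++ [A, B] ++ y ++ [A, C] ++ z ++ [B, C] ++ t)
      = splitCrossing A (x ++ [B, A] ++ y ++ [C, A] ++ z ++ [C, B] ++ t) := by
  simp only [List.mem_append, not_or] at hA hB hC
  obtain ⟨⟨⟨hAx, hAy⟩, hAz⟩, hAt⟩ := hA
  obtain ⟨⟨⟨hBx, hBy⟩, hBz⟩, hBt⟩ := hB
  obtain ⟨⟨⟨hCx, hCy⟩, hCz⟩, hCt⟩ := hC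
  have e1 : splitCrossing A (x ++ [A, B] ++ y ++ [A, C] ++ z ++ [B, C] ++ t)
      = crossing (x ++ [C] ++ z ++ [B, C] ++ t) (B :: y) := by
    simp [splitCrossing, part, switch, part_of_notMem, List.count_eq_zero_of_not_mem, hAx, hAy,
      hAz, hAt, hAB.symm, hAC.symm]
  have e2 : splitCrossing A (x ++ [B, A] ++ y ++ [C, A] ++ z ++ [C, B] ++ t)
      = crossing (x ++ [B] ++ z ++ [C, B] ++ t) (y ++ [C]) := by
    simp [splitCrossing, part, switch, part_of_notMem, List.count_eq_zero_of_not_mem, hAx, hAy,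
      hAz, hAt, hAB.symm, hAC.symm]
  rw [e1, e2, ← crossing_shift_right, ← crossing_map (Equiv.swap B C).injective.injOn]
  · simp [map_swap_of_notMem, *]
  · intro E hE
    have hEA : A ≠ E := by
      rintro rfl
      simp [hAB, hAy] at hE
    have hcount := h E (by simp at hE ⊢; tauto)
    rw [← hcount]
    simp [List.count_append, List.count_cons, hEA]
    omega

/-- The pairs `AC` and `CA` in a component that cyclically reads `yCAzCA` can be dropped. -/
theorem crossing_remove_interlaced_pair {A C : ℕ} {u y z : List ℕ} (hAC : A ≠ C)
    (hA : A ∉ u ++ y ++ z) (hC : C ∉ u ++ y ++ z)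
    (h : ∀ E ∈ y ++ z, (u ++ (y ++ z)).count E = 2) :
    crossing u (A :: (y ++ [C, A] ++ z ++ [C])) = crossing u (y ++ z) := by
  have hCA := hAC.symm
  have e : crossing u (y ++ [C, A] ++ z ++ [C] ++ [A]) = crossing u (y ++ z) := by
    -- `A` and `C` both occur twice in this component and not in `u`, so both are unshared.
    refine crossing_eq_of_shared
      (s := shared u (y ++ [C, A] ++ z ++ [C] ++ [A])) rfl ?_ fun E hE => ?_
    · have hs : shared u (y ++ [C, A] ++ z ++ [C] ++ [A]) C
          = shared u (y ++ [C, A] ++ z ++ [C] ++ [A]) A := by simp_all [shared]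
      generalize shared u (y ++ [C, A] ++ z ++ [C] ++ [A]) = s at hs ⊢
      have h1 := cyclicInversions_remove_pair hs (y ++ [C, A] ++ z) []
      have h2 := cyclicInversions_remove_pair hs y z
      simp only [List.append_assoc, List.append_nil, List.cons_append, List.nil_append] at h1 h2 ⊢
      rw [h1, h2]
    · have h1 : E ≠ A := by rintro rfl; simp_all
      have h2 : E ≠ C := by rintro rfl; simp_all
      simp [shared, h1, h2]
  simp only [List.mem_append, not_or] at hA hC
  rw [← crossing_shift_right, e]
  intro E hE
  by_cases hEA : A = E
  · subst hEA
    simp [List.count_append, List.count_eq_zero_of_not_mem, hCA, hA]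
  by_cases hEC : C = E
  · subst hEC
    simp [List.count_append, List.count_eq_zero_of_not_mem, hAC, hC]
  rw [← h E (by simpa [Ne.symm hEA, Ne.symm hEC] using hE)]
  simp [List.count_append, hEA, hEC]

/-- Splitting both sides of H3 at the displayed letter `B` yields `xACt|yACz` and `xt|AyCAzC`.
In both phrases `A` and `C` are either both shared or both unshared, and (after a shift)
adjacent, so both phrases have the invariant of `xt|yz`. -/
theorem splitCrossing_h3_snd {A B C : ℕ} {x y z t : List ℕ} (hAB : A ≠ B) (hAC : A ≠ C)
    (hBC : B ≠ C) (hA : A ∉ x ++ y ++ z ++ t) (hB : B ∉ x ++ y ++ z ++ t)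
    (hC : C ∉ x ++ y ++ z ++ t)
    (h : IsGauss (x ++ [A, B] ++ y ++ [A, C] ++ z ++ [B, C] ++ t)) :
    splitCrossing B (x ++ [A, B] ++ y ++ [A, C] ++ z ++ [B, C] ++ t)
      = splitCrossing B (x ++ [B, A] ++ y ++ [C, A] ++ z ++ [C, B] ++ t) := by
  simp only [List.mem_append, not_or] at hA hB hC
  obtain ⟨⟨⟨hAx, hAy⟩, hAz⟩, hAt⟩ := hA
  obtain ⟨⟨⟨hBx, hBy⟩, hBz⟩, hBt⟩ := hB
  obtain ⟨⟨⟨hCx, hCy⟩, hCz⟩, hCt⟩ := hC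
  have e1 : splitCrossing B (x ++ [A, B] ++ y ++ [A, C] ++ z ++ [B, C] ++ t)
      = crossing (x ++ [A, C] ++ t) (y ++ [A, C] ++ z) := by
    simp [splitCrossing, part, switch, part_of_notMem, List.count_eq_zero_of_not_mem, hBx, hBy,
      hBz, hBt, hAB, hBC.symm]
  have e2 : splitCrossing B (x ++ [B, A] ++ y ++ [C, A] ++ z ++ [C, B] ++ t)
      = crossing (x ++ t) (A :: (y ++ [C, A] ++ z ++ [C])) := by
    simp [splitCrossing, part, switch, part_of_notMem, List.count_eq_zero_of_not_mem, hBx, hBy,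
      hBz, hBt, hAB, hBC.symm]
  have e3 : crossing (x ++ [A, C] ++ t) (y ++ [A, C] ++ z) = crossing (x ++ t) (y ++ z) := by
    apply crossing_remove_pairs (A := A) (B := C) <;> simp [*]
  have e4 : crossing (x ++ t) (A :: (y ++ [C, A] ++ z ++ [C])) = crossing (x ++ t) (y ++ z) := by
    apply crossing_remove_interlaced_pair <;> simp [*]
    intro E hE
    have hEA : A ≠ E := by rintro rfl; simp [hAy, hAz] at hE
    have hEB : B ≠ E := by rintro rfl; simp [hBy, hBz] at hE
    have hEC : C ≠ E := by rintro rfl; simp [hCy, hCz] at hE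
    rw [← h E (by simp; tauto)]
    simp [List.count_append, hEA, hEB, hEC]
    omega
  rw [e1, e2, e3, e4]

/-- Splitting both sides of H3 at the displayed letter `C` yields `xAByAt|zB` and `xBAyBt|Az`,
which differ by a shift and by exchanging the names of `A` and `B`. -/
theorem splitCrossing_h3_trd {A B C : ℕ} {x y z t : List ℕ} (hAB : A ≠ B) (hAC : A ≠ C)
    (hBC : B ≠ C) (hA : A ∉ x ++ y ++ z ++ t) (hB : B ∉ x ++ y ++ z ++ t)
    (hC : C ∉ x ++ y ++ z ++ t)
    (h : IsGauss (x ++ [A, B] ++ y ++ [A, C] ++ z ++ [B, C] ++ t)) :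
    splitCrossing C (x ++ [A, B] ++ y ++ [A, C] ++ z ++ [B, C] ++ t)
      = splitCrossing C (x ++ [B, A] ++ y ++ [C, A] ++ z ++ [C, B] ++ t) := by
  simp only [List.mem_append, not_or] at hA hB hC
  obtain ⟨⟨⟨hAx, hAy⟩, hAz⟩, hAt⟩ := hA
  obtain ⟨⟨⟨hBx, hBy⟩, hBz⟩, hBt⟩ := hB
  obtain ⟨⟨⟨hCx, hCy⟩, hCz⟩, hCt⟩ := hC
  have e1 : splitCrossing C (x ++ [A, B] ++ y ++ [A, C] ++ z ++ [B, C] ++ t)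
      = crossing (x ++ [A, B] ++ y ++ [A] ++ t) (z ++ [B]) := by
    simp [splitCrossing, part, switch, part_of_notMem, List.count_eq_zero_of_not_mem, hCx, hCy,
      hCz, hCt, hAC, hBC]
  have e2 : splitCrossing C (x ++ [B, A] ++ y ++ [C, A] ++ z ++ [C, B] ++ t)
      = crossing (x ++ [B, A] ++ y ++ [B] ++ t) (A :: z) := by
    simp [splitCrossing, part, switch, part_of_notMem, List.count_eq_zero_of_not_mem, hCx, hCy,
      hCz, hCt, hAC, hBC]
  rw [e1, e2, ← crossing_shift_right, ← crossing_map (Equiv.swap A B).injective.injOn]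
  · simp [map_swap_of_notMem, *]
  · intro E hE
    by_cases hEA : A = E
    · subst hEA
      simp [List.count_append, List.count_eq_zero_of_not_mem, hAB.symm, *]
    have hEB : B ≠ E := by
      rintro rfl
      simp [hAB.symm, hBz] at hE
    have hEC : C ≠ E := by
      rintro rfl
      simp [hAC.symm, hCz] at hE
    have hcount := h E (by simp at hE ⊢; tauto)
    rw [← hcount]
    simp [List.count_append, hEA, hEB, hEC]
    omega

theorem totalCrossing_h3 {A B C : ℕ} {x y z t : List ℕ}
    (h : IsGauss (x ++ [A, B] ++ y ++ [A, C] ++ z ++ [B, C] ++ t)) :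
    totalCrossing (x ++ [A, B] ++ y ++ [A, C] ++ z ++ [B, C] ++ t)
      = totalCrossing (x ++ [B, A] ++ y ++ [C, A] ++ z ++ [C, B] ++ t) := by
  have hset : (x ++ [B, A] ++ y ++ [C, A] ++ z ++ [C, B] ++ t).toFinset
      = (x ++ [A, B] ++ y ++ [A, C] ++ z ++ [B, C] ++ t).toFinset := by ext; simp; tauto
  obtain ⟨⟨hAB, hAC, hBC⟩, hA, hB, hC⟩ :=
    notMem_of_count_h3 (h A (by simp)) (h B (by simp)) (h C (by simp))
  rw [totalCrossing, totalCrossing, hset]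
  refine Finset.sum_congr rfl fun D _ => ?_
  by_cases hDA : A = D
  · subst hDA
    exact splitCrossing_h3_fst hAB hAC hA hB hC h
  by_cases hDB : B = D
  · subst hDB
    exact splitCrossing_h3_snd hAB hAC hBC hA hB hC h
  by_cases hDC : C = D
  · subst hDC
    exact splitCrossing_h3_trd hAB hAC hBC hA hB hC h
  exact (splitCrossing_h3 hDA hDB hDC hAB hAC hBC hA hB hC).symm

namespace GaussWord

theorem totalCrossing_eq_of_step {u v : GaussWord} (h : Step u v) :
    totalCrossing u.word = totalCrossing v.word := by
  rcases h with (⟨f, hf, h⟩ | h) | ⟨A, x, y, h1, h2⟩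
  · rw [← h, totalCrossing_map hf]
  · have hu := u.isGauss
    have hv := v.isGauss
    generalize u.word = l at *
    generalize v.word = l' at *
    cases h with
    | h1 A x y => exact totalCrossing_h1 hu
    | h2 A B x y z => exact totalCrossing_h2 hu hv
    | h3 A B C x y z t => exact totalCrossing_h3 hu
  · have hu := u.isGauss
    have h1 : u.word = A :: (x ++ [A] ++ y) := by simpa using h1
    rw [h1] at hu ⊢
    rw [h2]
    exact (totalCrossing_shift (A := A) (w := x ++ [A] ++ y) hu).symm

theorem totalCrossing_eq_of_homotopic {u v : GaussWord} (h : Homotopic u v) :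
    totalCrossing u.word = totalCrossing v.word := by
  induction h with
  | rel _ _ h => exact totalCrossing_eq_of_step h
  | refl => rfl
  | symm _ _ _ ih => exact ih.symm
  | trans _ _ _ _ _ ih1 ih2 => exact ih1.trans ih2

theorem Homotopic.of_openHomotopic {u v : GaussWord} (h : OpenHomotopic u v) : Homotopic u v :=
  Relation.EqvGen.mono (fun _ _ => Or.inl) _ _ h

theorem not_homotopicallyTrivial_witness : ¬ witness.HomotopicallyTrivial := fun h =>
  absurd (totalCrossing_eq_of_homotopic h) (by decide)

/-! ### The invariant `z` of the witness -/

theorem crossing_t (w : GaussWord) : w.t.crossing = 0 :=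
  crossing_nil_left w.word

/-- The homomorphism from `G` to `ZMod 2` extending `crossing`. -/
noncomputable def crossingHom : G →+ ZMod 2 := FreeAbelianGroup.lift GaussPhrase.Classes.crossing

theorem crossingHom_eq_zero_of_mem {a : G} (h : a ∈ twoG) : crossingHom a = 0 := by
  obtain ⟨b, rfl⟩ := h
  rw [zsmulAddGroupHom_apply, map_zsmul, zsmul_eq_mul]
  exact (congrArg (· * _) two_eq_zero_mod).trans (zero_mul _)

theorem crossingHom_g (w : GaussWord) :
    crossingHom w.g = ∑ A : {A // A ∈ w.alphabet}, (w.p A.1 A.2).crossing := by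
  rw [g, map_sum]
  refine Finset.sum_congr rfl fun A _ => ?_
  rw [map_sub, crossingHom, FreeAbelianGroup.lift_apply_of, FreeAbelianGroup.lift_apply_of,
    crossing_t, sub_zero]
  rfl

theorem z_witness_ne_zero : witness.z ≠ 0 := by
  intro h
  have h1 : witness.g ∈ twoG := (QuotientAddGroup.eq_zero_iff _).1 h
  have h2 := crossingHom_eq_zero_of_mem h1
  rw [crossingHom_g] at h2
  revert h2
  decide

end GaussWord

theorem GaussPhrase.cls_witness_ne : GaussPhrase.witness.cls ≠ GaussWord.witness.t := fun h =>
  absurd ((congrArg GaussPhrase.Classes.crossing h).trans (GaussWord.crossing_t _)) (by decide)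

end GaussHomotopy

theorem corollary4p4 :
    (∃ w : GaussHomotopy.GaussWord, ¬ w.HomotopicallyTrivial) ∧
    ¬ GaussHomotopy.TuraevConjecture ∧
    ¬ GaussHomotopy.GaussWord.witness.HomotopicallyTrivial ∧
    GaussHomotopy.GaussWord.witness.z ≠ 0 ∧
    GaussHomotopy.GaussPhrase.witness.cls ≠ GaussHomotopy.GaussWord.witness.t :=
  ⟨⟨_, GaussHomotopy.GaussWord.not_homotopicallyTrivial_witness⟩,
    fun h => GaussHomotopy.GaussWord.not_homotopicallyTrivial_witness
      (GaussHomotopy.GaussWord.Homotopic.of_openHomotopic (h _)),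
    GaussHomotopy.GaussWord.not_homotopicallyTrivial_witness,
    GaussHomotopy.GaussWord.z_witness_ne_zero, GaussHomotopy.GaussPhrase.cls_witness_ne⟩
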